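/- Let $R$ be a noetherian regular local ring of dimension $2$ with maximal ideal $\mathfrak m$, residue field $K=R/\mathfrak m$ and fraction field $F$. Let $R_v$ be a prime divisor of $R$, i.e. a discrete valuation ring with fraction field $F$ which contains $R$ and dominates it ($\mathfrak m_v\cap R=\mathfrak m$, where $\mathfrak m_v$ is the maximal ideal of $R_v$), and whose residue field $K_v=R_v/\mathfrak m_v$ has transcendence degree $1$ over $K$. Let $\mathrm{Res}_v:R_v\to K_v$ be the residue map, and let $K'$ be the relative algebraic closure of $K$ in $K_v$. Let $z\in F$, $z\neq 0$, and suppose that $R_v$ is a dicritical divisor of $z$, i.e. $z\in R_v$ and $\mathrm{Res}_v(z)$ is transcendental over $K$. Suppose that there are $x\in\mathfrak m\setminus\mathfrak m^2$ and $m\in\mathbb N=\{0,1,2,\dots\}$ such that $z\,x^m\in R$. Then there is an element $t\in K_v$, transcendental over $K$, such that $K_v=K'(t)$ and $\mathrm{Res}_v(z)\in K'[t]$. -/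

import Mathlib

open IsLocalRing

/-- Let `R` be a local domain with fraction field `F`, and let `V` be a valuation ring of `F` that
contains `R` (expressed by the compatible algebra structures) and dominates it (the inclusion
`R → V` is a local homomorphism, i.e. `𝔪_V ∩ R = 𝔪_R`). Then `V` is a *prime divisor* of the
two-dimensional ring `R` if it is a discrete valuation ring whose residue field has transcendence
degree one over the residue field of `R`. -/
structure IsPrimeDivisor (R : Type*) [CommRing R] [IsLocalRing R] {F : Type*} [Field F]
    [Algebra R F] (V : ValuationSubring F) [Algebra R V] [IsScalarTower R V F]
    [IsLocalHom (algebraMap R V)] : Prop where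
  isDiscreteValuationRing : IsDiscreteValuationRing V
  trdeg_residueField : Algebra.trdeg (ResidueField R) (ResidueField V) = 1

/-- A prime divisor `V` of `R` is a *dicritical divisor* of the nonzero element `z` of the fraction
field if `z ∈ V` and the residue of `z` is transcendental over the residue field of `R`. -/
structure IsDicriticalDivisor (R : Type*) [CommRing R] [IsLocalRing R] {F : Type*} [Field F]
    [Algebra R F] (V : ValuationSubring F) [Algebra R V] [IsScalarTower R V F]
    [IsLocalHom (algebraMap R V)] (z : F) : Prop where
  isPrimeDivisor : IsPrimeDivisor R V
  ne_zero : z ≠ 0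
  mem : z ∈ V
  transcendental_residue : Transcendental (ResidueField R) (residue V ⟨z, mem⟩)

/-!
Write `L` for the residue field of the discrete valuation ring `D = R_v`, and `K'` for the relative
algebraic closure in `L` of the residue field of `R`. The proof follows `D` through a sequence of
monomial blow-ups of `R`. None of the intermediate rings needs to be localized, noetherian or
regular: it suffices to carry an `R`-subalgebra `A` of `D` whose intersection with the maximal ideal
of `D` is generated by two elements `x`, `y` of `A`, whose residues all lie in `K'`, and for which
`z * x ^ m ∈ A` for some `m` (`IsParameterPair`). At the start `A` is the image of `R`.

If the values of `x` and `y` are in the ratio `p : q` with `p`, `q` coprime, then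
`x = w ^ p * τ ^ (-β)` and `y = w ^ q * τ ^ α` for a nonunit `w`, a unit `τ` of `D` and integers
with `α p + β q = 1` (`exists_isMonomialPair`), so that `τ = y ^ p / x ^ q`.

* If the residue of `τ` is algebraic, pass to `A[w, τ, τ⁻¹]`. Modulo `w` it is a quotient of a
  Laurent polynomial ring over a field, so its intersection with the maximal ideal is generated by
  `w` and the value at `τ` of one polynomial (`IsParameterPair.exists_toricTransform`). Since `x` is
  a power of `w` up to a unit of the new ring, `z` is again an element of the ring divided by a power
  of its first parameter. As `z * x ^ m` lies in the maximal ideal, one factor `w` can be cancelled,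
  so the value of the denominator drops, and this happens only finitely often.
* If the residue `t` of `τ` is transcendental, then the valuation is monomial in `x` and `y`: an
  element of `A` divisible by `w ^ e` is an `A`-combination of monomials `x ^ i * y ^ j` of weight
  `i p + j q ≥ e` (`IsParameterPair.mem_weightFiltration`). Dividing by `w ^ e` and taking residues
  shows that `L = K'(t)` (`IsParameterPair.adjoin_residue_eq_top`). For the element `z * x ^ m`, a
  monomial `x ^ i * y ^ j` of weight `m p` satisfies `x ^ i * y ^ j / x ^ m = τ ^ k` with
  `j = p k`; hence `k ≥ 0`, and the residue of `z` is a polynomial in `t`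
  (`IsParameterPair.residue_mem_adjoin`).
-/

open Polynomial

/-! ### Regular parameters, kernels of evaluation maps, and independence of powers -/

theorem IsRegularLocalRing.exists_maximalIdeal_eq_span_pair {R : Type*} [CommRing R]
    [IsRegularLocalRing R] (hdim : ringKrullDim R = 2) {x : R} (hx : x ∈ maximalIdeal R)
    (hx' : x ∉ maximalIdeal R ^ 2) : ∃ y, maximalIdeal R = Ideal.span {x, y} := by
  have hfin : Module.finrank (ResidueField R) (CotangentSpace R) = 2 := by
    have h := (IsRegularLocalRing.iff_finrank_cotangentSpace R).1 inferInstance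
    rw [hdim] at h
    exact_mod_cast h
  set c := (maximalIdeal R).toCotangent
  have hc : c ⟨x, hx⟩ ≠ 0 := fun h => hx' ((Ideal.toCotangent_eq_zero _ _).1 h)
  obtain ⟨v, hv⟩ : ∃ v : CotangentSpace R, LinearIndependent (ResidueField R)
      ![(c ⟨x, hx⟩ : CotangentSpace R), v] :=
    exists_linearIndependent_pair_of_one_lt_finrank (by omega) hc
  obtain ⟨y, rfl⟩ := (maximalIdeal R).toCotangent_surjective v
  have hspan := hv.span_eq_top_of_card_eq_finrank (by simp [hfin])
  rw [Matrix.range_cons, Matrix.range_cons, Matrix.range_empty, Set.union_empty,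
    Set.singleton_union] at hspan
  have h2 : c '' {⟨x, hx⟩, y} = {c ⟨x, hx⟩, c y} := Set.image_pair _ _ _
  have h3 := CotangentSpace.span_image_eq_top_iff.1 (h2.symm ▸ hspan)
  refine ⟨y, ?_⟩
  have h4 := congrArg (Submodule.map (maximalIdeal R).subtype) h3
  rw [Submodule.map_span, Submodule.map_top, Submodule.range_subtype, Set.image_pair] at h4
  exact h4.symm

/-- If the image of `φ : A →+* L` is a field, then the polynomials over `A` that vanish at `t` are the
multiples of a single one, up to polynomials with coefficients in the kernel of `φ`. -/
theorem Polynomial.exists_ker_eval₂_generator {A L : Type*} [CommRing A] [Field L] (φ : A →+* L)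
    (hφ : ∀ a, φ a ≠ 0 → ∃ b, φ (a * b) = 1) (t : L) :
    ∃ g : A[X], eval₂ φ t g = 0 ∧
      ∀ P : A[X], eval₂ φ t P = 0 → ∃ h : A[X], ∀ i, φ ((P - g * h).coeff i) = 0 := by
  -- The image of `φ` is a field, so polynomials over it form a principal ideal ring.
  have hmax : (RingHom.ker φ).IsMaximal := by
    refine Ideal.isMaximal_iff.2 ⟨by simp [RingHom.mem_ker], fun J a hJ ha haJ => ?_⟩
    obtain ⟨b, hb⟩ := hφ a ha
    have h1 : 1 - a * b ∈ J := hJ (by simp [RingHom.mem_ker, hb])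
    have h2 := J.add_mem h1 (J.mul_mem_right b haJ)
    rwa [sub_add_cancel] at h2
  let := Ideal.Quotient.field (RingHom.ker φ)
  let ψ : A ⧸ RingHom.ker φ →+* L := RingHom.kerLift φ
  have hψ : ψ.comp (Ideal.Quotient.mk (RingHom.ker φ)) = φ := RingHom.ext fun a => rfl
  obtain ⟨g₀, hg₀⟩ := (IsPrincipalIdealRing.principal (RingHom.ker (eval₂RingHom ψ t))).principal
  have hmap := Polynomial.map_surjective _ (Ideal.Quotient.mk_surjective (I := RingHom.ker φ))
  have hev : ∀ P : A[X], eval₂RingHom ψ t (P.map (Ideal.Quotient.mk (RingHom.ker φ)))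
      = eval₂ φ t P := fun P => by
    rw [coe_eval₂RingHom, eval₂_map, hψ]
  obtain ⟨g, rfl⟩ := hmap g₀
  refine ⟨g, ?_, fun P hP => ?_⟩
  · rw [← hev, ← RingHom.mem_ker, hg₀]
    exact Submodule.mem_span_singleton_self _
  · rw [← hev, ← RingHom.mem_ker, hg₀] at hP
    obtain ⟨h₀, hh⟩ := Ideal.mem_span_singleton.1 hP
    obtain ⟨h, rfl⟩ := hmap h₀
    refine ⟨h, fun i => ?_⟩
    rw [← RingHom.mem_ker, ← Ideal.Quotient.eq_zero_iff_mem, ← coeff_map, Polynomial.map_sub,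
      Polynomial.map_mul, hh, sub_self, coeff_zero]

theorem Transcendental.linearIndependent_zpow {k L : Type*} [Field k] [Field L] [Algebra k L]
    {t : L} (ht : Transcendental k t) : LinearIndependent k fun n : ℤ => t ^ n := by
  have ht0 : t ≠ 0 := by
    rintro rfl
    exact ht isAlgebraic_zero
  rw [linearIndependent_iff']
  intro s c hc i hi
  -- Multiplying a relation by a large power of `t` makes it polynomial.
  obtain ⟨N, hN⟩ : ∃ N : ℕ, ∀ j ∈ s, 0 ≤ j + N := by
    refine ⟨∑ j ∈ s, j.natAbs, fun j hj => ?_⟩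
    have := Finset.single_le_sum (f := fun j : ℤ => j.natAbs) (fun _ _ => Nat.zero_le _) hj
    omega
  have h0 : Polynomial.aeval t (∑ j ∈ s, C (c j) * X ^ (j + N).toNat) = 0 := by
    rw [map_sum, ← zero_mul (t ^ (N : ℤ)), ← hc, Finset.sum_mul]
    refine Finset.sum_congr rfl fun j hj => ?_
    rw [map_mul, aeval_C, map_pow, aeval_X, Algebra.smul_def, mul_assoc, ← zpow_add₀ ht0,
      ← zpow_natCast, Int.toNat_of_nonneg (hN j hj)]
  have h1 := congrArg (fun P => coeff P (i + N).toNat) (transcendental_iff.1 ht _ h0)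
  simp only [finsetSum_coeff, coeff_C_mul, coeff_X_pow, coeff_zero] at h1
  rw [Finset.sum_eq_single i] at h1
  · simpa using h1
  · intro j hj hji
    have := hN j hj
    have := hN i hi
    rw [if_neg (by omega), mul_zero]
  · exact fun h => absurd hi h

/-! ### Two elements of a discrete valuation ring as monomials -/

/-- The elements `x` and `y` of the local ring `D` are written as `w ^ p * τ ^ (-β)` and
`w ^ q * τ ^ α`, with a nonzero nonunit `w`, a unit `τ`, positive exponents `p`, `q` and
`α p + β q = 1`. The integer matrix of exponents has determinant `1`, so that `w = x ^ α * y ^ β` and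
`τ = y ^ p / x ^ q` in the fraction field when `D` is a domain. -/
structure IsMonomialPair {D : Type*} [CommRing D] [IsLocalRing D] (x y w : D) (τ : Dˣ) (p q : ℕ)
    (α β : ℤ) : Prop where
  mem : w ∈ maximalIdeal D
  ne_zero : w ≠ 0
  pos_left : 0 < p
  pos_right : 0 < q
  bezout : α * p + β * q = 1
  left : x = w ^ p * ↑(τ ^ (-β))
  right : y = w ^ q * ↑(τ ^ α)

theorem exists_isMonomialPair {D : Type*} [CommRing D] [IsDomain D] [IsDiscreteValuationRing D]
    {x y : D} (hx : x ∈ maximalIdeal D) (hx0 : x ≠ 0) (hy : y ∈ maximalIdeal D) (hy0 : y ≠ 0) :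
    ∃ w τ p q α β, IsMonomialPair x y w τ p q α β := by
  obtain ⟨π, hπ⟩ := IsDiscreteValuationRing.exists_irreducible D
  obtain ⟨a, ε, rfl⟩ := IsDiscreteValuationRing.eq_unit_mul_pow_irreducible hx0 hπ
  obtain ⟨b, δ, rfl⟩ := IsDiscreteValuationRing.eq_unit_mul_pow_irreducible hy0 hπ
  have ha : 0 < a := by
    rcases Nat.eq_zero_or_pos a with rfl | h
    · simp at hx
    · exact h
  have hb : 0 < b := by
    rcases Nat.eq_zero_or_pos b with rfl | h
    · simp at hy
    · exact h
  have hg := Nat.gcd_pos_of_pos_left b ha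
  obtain ⟨p, hp⟩ := Nat.gcd_dvd_left a b
  obtain ⟨q, hq⟩ := Nat.gcd_dvd_right a b
  have hbez := Nat.gcd_eq_gcd_ab a b
  set g := Nat.gcd a b with hgdef
  set α := Nat.gcdA a b
  set β := Nat.gcdB a b
  have hbez' : α * p + β * q = 1 := by
    have h : (g : ℤ) * (α * p + β * q) = g * 1 := by
      rw [mul_one]
      conv_rhs => rw [hbez]
      rw [hp, hq]
      push_cast
      ring
    exact mul_left_cancel₀ (by exact_mod_cast hg.ne') h
  -- Inverting the exponent matrix in the group of units, written additively.
  have key : ∀ {G : Type _} [AddCommGroup G] (a b : G),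
      a = p • (α • a + β • b) + (-β) • ((p : ℤ) • b + (-(q : ℤ)) • a) ∧
        b = q • (α • a + β • b) + α • ((p : ℤ) • b + (-(q : ℤ)) • a) := by
    intro G _ a b
    simp only [← natCast_zsmul]
    constructor
    · nth_rewrite 1 [← one_zsmul a, ← hbez']
      module
    · nth_rewrite 1 [← one_zsmul b, ← hbez']
      module
  have hε : ε = (ε ^ α * δ ^ β) ^ p * (δ ^ (p : ℤ) * ε ^ (-(q : ℤ))) ^ (-β) :=
    (key (Additive.ofMul ε) (Additive.ofMul δ)).1
  have hδ : δ = (ε ^ α * δ ^ β) ^ q * (δ ^ (p : ℤ) * ε ^ (-(q : ℤ))) ^ α :=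
    (key (Additive.ofMul ε) (Additive.ofMul δ)).2
  refine ⟨↑(ε ^ α * δ ^ β) * π ^ g, δ ^ (p : ℤ) * ε ^ (-(q : ℤ)), p, q, α, β, ?_, ?_, ?_, ?_,
    hbez', ?_, ?_⟩
  · exact Ideal.mul_mem_left _ _ (Ideal.pow_mem_of_mem _ hπ.not_isUnit _ hg)
  · exact mul_ne_zero (Units.ne_zero _) (pow_ne_zero _ hπ.ne_zero)
  · exact Nat.pos_of_mul_pos_left (hp ▸ ha)
  · exact Nat.pos_of_mul_pos_left (hq ▸ hb)
  · conv_lhs => rw [hε, hp]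
    push_cast
    ring
  · conv_lhs => rw [hδ, hq]
    push_cast
    ring


section

variable {R D : Type*} [CommRing R] [CommRing D] [Algebra R D]

/-! ### The monomial blow-up -/

/-- The chart `A[w, τ, τ⁻¹]` of a monomial blow-up of `A`, as a subalgebra of `D`. -/
def toricTransform (A : Subalgebra R D) (w : D) (τ : Dˣ) : Subalgebra R D :=
  Algebra.adjoin R (A ∪ {w, ↑τ, ↑τ⁻¹})

variable {A : Subalgebra R D} {w : D} {τ : Dˣ}

theorem le_toricTransform : A ≤ toricTransform A w τ := fun _ ha =>
  Algebra.subset_adjoin (Or.inl ha)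

theorem mem_toricTransform : w ∈ toricTransform A w τ :=
  Algebra.subset_adjoin (by simp)

theorem unit_mem_toricTransform : (τ : D) ∈ toricTransform A w τ :=
  Algebra.subset_adjoin (by simp)

theorem unit_inv_mem_toricTransform : ((τ⁻¹ : Dˣ) : D) ∈ toricTransform A w τ :=
  Algebra.subset_adjoin (by simp)

theorem unit_zpow_mem_toricTransform (n : ℤ) : ((τ ^ n : Dˣ) : D) ∈ toricTransform A w τ := by
  cases n with
  | ofNat n =>
    rw [Int.ofNat_eq_natCast, zpow_natCast, Units.val_pow_eq_pow_val]
    exact pow_mem unit_mem_toricTransform n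
  | negSucc n =>
    rw [zpow_negSucc, ← inv_pow, Units.val_pow_eq_pow_val]
    exact pow_mem unit_inv_mem_toricTransform _

theorem aeval_mem_toricTransform (P : A[X]) :
    Polynomial.aeval (τ : D) P ∈ toricTransform A w τ := by
  rw [aeval_eq_sum_range]
  exact sum_mem fun i _ => mul_mem (le_toricTransform (P.coeff i).2)
    (pow_mem unit_mem_toricTransform i)

/-- Modulo `w`, every element of `A[w, τ, τ⁻¹]` is a Laurent polynomial in `τ` over `A`. -/
theorem exists_pow_mul_eq_of_mem_toricTransform {a : D} (ha : a ∈ toricTransform A w τ) :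
    ∃ (n : ℕ) (P : A[X]), ∃ b ∈ toricTransform A w τ,
      (τ : D) ^ n * a = Polynomial.aeval (τ : D) P + w * b := by
  induction ha using Algebra.adjoin_induction with
  | mem a h =>
    rcases h with h | rfl | rfl | rfl
    · exact ⟨0, C ⟨a, h⟩, 0, zero_mem _, by simp [aeval_C]⟩
    · exact ⟨0, 0, 1, one_mem _, by simp⟩
    · exact ⟨0, X, 0, zero_mem _, by simp⟩
    · exact ⟨1, 1, 0, zero_mem _, by simp⟩
  | algebraMap r =>
    exact ⟨0, C ⟨algebraMap R D r, A.algebraMap_mem r⟩, 0, zero_mem _,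
      by simp [aeval_C]⟩
  | add a a' _ _ h h' =>
    obtain ⟨n, P, b, hb, e⟩ := h
    obtain ⟨n', P', b', hb', e'⟩ := h'
    refine ⟨n + n', P * X ^ n' + P' * X ^ n, τ ^ n' * b + τ ^ n * b', add_mem (mul_mem
      (pow_mem unit_mem_toricTransform _) hb) (mul_mem (pow_mem unit_mem_toricTransform _) hb'), ?_⟩
    simp only [map_add, map_mul, map_pow, aeval_X]
    linear_combination (τ : D) ^ n' * e + (τ : D) ^ n * e'
  | mul a a' _ _ h h' =>
    obtain ⟨n, P, b, hb, e⟩ := h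
    obtain ⟨n', P', b', hb', e'⟩ := h'
    refine ⟨n + n', P * P', b * Polynomial.aeval (τ : D) P' + Polynomial.aeval (τ : D) P * b'
      + w * b * b', ?_, ?_⟩
    · exact add_mem (add_mem (mul_mem hb (aeval_mem_toricTransform _))
        (mul_mem (aeval_mem_toricTransform _) hb')) (mul_mem (mul_mem mem_toricTransform hb) hb')
    · rw [map_mul, pow_add]
      linear_combination (τ : D) ^ n' * a' * e + (Polynomial.aeval (τ : D) P + w * b) * e'

variable {x y : D} {p q : ℕ} {α β : ℤ}

theorem IsMonomialPair.left_dvd [IsLocalRing D] (hw : IsMonomialPair x y w τ p q α β) :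
    ∃ b ∈ toricTransform A w τ, x = w * b := by
  refine ⟨w ^ (p - 1) * ↑(τ ^ (-β)), mul_mem (pow_mem mem_toricTransform _)
    (unit_zpow_mem_toricTransform _), ?_⟩
  rw [← mul_assoc, mul_pow_sub_one hw.pos_left.ne']
  exact hw.left

theorem IsMonomialPair.right_dvd [IsLocalRing D] (hw : IsMonomialPair x y w τ p q α β) :
    ∃ b ∈ toricTransform A w τ, y = w * b := by
  refine ⟨w ^ (q - 1) * ↑(τ ^ α), mul_mem (pow_mem mem_toricTransform _)
    (unit_zpow_mem_toricTransform _), ?_⟩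
  rw [← mul_assoc, mul_pow_sub_one hw.pos_right.ne']
  exact hw.right

end

section

theorem residue_zpow {D : Type*} [CommRing D] [IsLocalRing D] (τ : Dˣ) (n : ℤ) :
    residue D ↑(τ ^ n) = residue D ↑τ ^ n :=
  congrArg Units.val (map_zpow (Units.map (residue D : D →* ResidueField D)) τ n) |>.trans
    (Units.val_zpow_eq_zpow_val _ _)

variable {R D : Type*} [CommRing R] [IsLocalRing R] [CommRing D] [IsLocalRing D]
  [Algebra R D] [IsLocalHom (algebraMap R D)]

/-- The nonzero elements `x` and `y` of the subalgebra `A` of the local ring `D` generate the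
intersection of `A` with the maximal ideal of `D`, and the residues of the elements of `A` are
algebraic over the residue field of `R`. The subalgebra `A` is not required to be local, and `x` and
`y` are allowed to be redundant, for instance equal. -/
structure IsParameterPair (A : Subalgebra R D) (x y : D) : Prop where
  left_mem : x ∈ A
  right_mem : y ∈ A
  left_mem_maximalIdeal : x ∈ maximalIdeal D
  right_mem_maximalIdeal : y ∈ maximalIdeal D
  left_ne_zero : x ≠ 0
  right_ne_zero : y ≠ 0
  exists_eq : ∀ a ∈ A, residue D a = 0 → ∃ b ∈ A, ∃ c ∈ A, a = b * x + c * y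
  residue_mem : ∀ a ∈ A, residue D a ∈ algebraicClosure (ResidueField R) (ResidueField D)

/-- The residues of a subalgebra of `D`, if algebraic over the residue field of `R`, form a field. -/
theorem exists_mem_residue_mul_eq_one {A : Subalgebra R D} {a : D} (ha : a ∈ A)
    (halg : residue D a ∈ algebraicClosure (ResidueField R) (ResidueField D))
    (h0 : residue D a ≠ 0) : ∃ b ∈ A, residue D (a * b) = 1 := by
  have h := (mem_algebraicClosure_iff'.1 halg).inv_mem_adjoin
  rw [Algebra.adjoin_singleton_eq_range_aeval] at h
  obtain ⟨P, hP⟩ := h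
  obtain ⟨Q, rfl⟩ := Polynomial.map_surjective _ (residue_surjective (R := R)) P
  refine ⟨Polynomial.aeval a Q, ?_, ?_⟩
  · have h1 := Subalgebra.aeval_coe A ⟨a, ha⟩ Q
    exact h1 ▸ Subtype.property _
  · have h1 : residue D (Polynomial.aeval a Q) = (residue D a)⁻¹ := by
      rw [← hP, aeval_def, hom_eval₂]
      simp only [AlgHom.toRingHom_eq_coe, RingHom.coe_coe]
      rw [aeval_def, eval₂_map]
      rfl
    rw [map_mul, h1, mul_inv_cancel₀ h0]

variable {A : Subalgebra R D} {w x y : D} {τ : Dˣ} {p q : ℕ} {α β : ℤ}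

/-- The intersection of `A` with the maximal ideal becomes divisible by `w` in the monomial blow-up. -/
theorem IsParameterPair.exists_eq_mul (hA : IsParameterPair A x y)
    (hw : IsMonomialPair x y w τ p q α β) {a : D} (ha : a ∈ A) (h0 : residue D a = 0) :
    ∃ b ∈ toricTransform A w τ, a = w * b := by
  obtain ⟨b, hb, c, hc, rfl⟩ := hA.exists_eq a ha h0
  obtain ⟨d, hd, hxd⟩ := hw.left_dvd (A := A)
  obtain ⟨e, he, hye⟩ := hw.right_dvd (A := A)
  refine ⟨b * d + c * e, add_mem (mul_mem (le_toricTransform hb) hd)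
    (mul_mem (le_toricTransform hc) he), ?_⟩
  rw [hxd, hye]
  ring

/-- If the residue of `τ` is algebraic, then the monomial blow-up has a pair of parameters with first
member `w`. -/
theorem IsParameterPair.exists_toricTransform (hA : IsParameterPair A x y)
    (hw : IsMonomialPair x y w τ p q α β)
    (hτ : residue D τ ∈ algebraicClosure (ResidueField R) (ResidueField D)) :
    ∃ y', IsParameterPair (toricTransform A w τ) w y' := by
  have hres : ∀ a ∈ toricTransform A w τ,
      residue D a ∈ algebraicClosure (ResidueField R) (ResidueField D) := by
    intro a ha
    induction ha using Algebra.adjoin_induction with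
    | mem a h =>
      rcases h with h | rfl | rfl | rfl
      · exact hA.residue_mem a h
      · rw [(residue_eq_zero_iff _).2 hw.mem]
        exact zero_mem _
      · exact hτ
      · rw [map_units_inv]
        exact inv_mem hτ
    | algebraMap r => exact hA.residue_mem _ (A.algebraMap_mem r)
    | add a a' _ _ h h' => rw [map_add]; exact add_mem h h'
    | mul a a' _ _ h h' => rw [map_mul]; exact mul_mem h h'
  have hwres : residue D w = 0 := (residue_eq_zero_iff _).2 hw.mem
  let φ : A →+* ResidueField D := (residue D).comp A.val.toRingHom
  have hev : ∀ P : A[X], residue D (Polynomial.aeval (τ : D) P) = eval₂ φ (residue D τ) P :=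
    fun P => by
      rw [aeval_def, hom_eval₂]
      rfl
  obtain ⟨g, hg, hgen⟩ := Polynomial.exists_ker_eval₂_generator φ (fun a ha => by
    obtain ⟨b, hb, h1⟩ := exists_mem_residue_mul_eq_one a.2 (hA.residue_mem a a.2) ha
    exact ⟨⟨b, hb⟩, h1⟩) (residue D τ)
  have hker : ∀ a ∈ toricTransform A w τ, residue D a = 0 →
      ∃ b ∈ toricTransform A w τ, ∃ c ∈ toricTransform A w τ,
        a = b * w + c * Polynomial.aeval (τ : D) g := by
    intro a ha ha0
    obtain ⟨n, P, b, hb, e⟩ := exists_pow_mul_eq_of_mem_toricTransform ha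
    have hP : eval₂ φ (residue D τ) P = 0 := by
      have := congrArg (residue D) e
      rw [map_mul, map_add, map_mul, ha0, hwres, mul_zero, zero_mul, add_zero, hev] at this
      exact this.symm
    obtain ⟨h, hh⟩ := hgen P hP
    have hr : ∃ c ∈ toricTransform A w τ,
        Polynomial.aeval (τ : D) (P - g * h) = w * c := by
      choose c hc hce using fun i => hA.exists_eq_mul hw ((P - g * h).coeff i).2 (hh i)
      rw [aeval_eq_sum_range]
      refine ⟨∑ i ∈ Finset.range ((P - g * h).natDegree + 1), c i * (τ : D) ^ i,
        sum_mem fun i _ => mul_mem (hc i) (pow_mem unit_mem_toricTransform i), ?_⟩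
      rw [Finset.mul_sum]
      refine Finset.sum_congr rfl fun i _ => ?_
      rw [← mul_assoc, ← hce]
      rfl
    obtain ⟨c, hc, hce⟩ := hr
    have hτn : ((τ⁻¹ ^ n : Dˣ) : D) * (τ : D) ^ n = 1 := by
      rw [← Units.val_pow_eq_pow_val, ← Units.val_mul, ← mul_pow, inv_mul_cancel, one_pow,
        Units.val_one]
    have hτm : ((τ⁻¹ ^ n : Dˣ) : D) ∈ toricTransform A w τ := by
      rw [Units.val_pow_eq_pow_val]
      exact pow_mem unit_inv_mem_toricTransform _
    refine ⟨((τ⁻¹ ^ n : Dˣ) : D) * (b + c), mul_mem hτm (add_mem hb hc),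
      ((τ⁻¹ ^ n : Dˣ) : D) * Polynomial.aeval (τ : D) h,
      mul_mem hτm (aeval_mem_toricTransform _), ?_⟩
    rw [map_sub, map_mul] at hce
    linear_combination ((τ⁻¹ ^ n : Dˣ) : D) * (e + hce) - a * hτn
  -- If the second generator vanishes, it is superfluous and is replaced by `w`.
  by_cases hg0 : Polynomial.aeval (τ : D) g = 0
  · refine ⟨w, mem_toricTransform, mem_toricTransform, hw.mem, hw.mem, hw.ne_zero, hw.ne_zero,
      fun a ha ha0 => ?_, hres⟩
    obtain ⟨b, hb, c, hc, e⟩ := hker a ha ha0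
    exact ⟨b, hb, 0, zero_mem _, by rw [e, hg0, mul_zero, zero_mul]⟩
  · exact ⟨Polynomial.aeval (τ : D) g, mem_toricTransform, aeval_mem_toricTransform g, hw.mem,
      (residue_eq_zero_iff _).1 ((hev g).trans hg), hw.ne_zero, hg0, hker, hres⟩

/-! ### The filtration by weight, and the monomial case -/

/-- The `A`-submodule of `D` spanned by the monomials `x ^ i * y ^ j` of weight `i p + j q` at least
`e`. -/
def weightFiltration (A : Subalgebra R D) (x y : D) (p q e : ℕ) : Submodule A D :=
  Submodule.span A ((fun s : ℕ × ℕ => x ^ s.1 * y ^ s.2) '' {s | e ≤ s.1 * p + s.2 * q})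

theorem IsMonomialPair.pow_mul_pow (hw : IsMonomialPair x y w τ p q α β) (i j : ℕ) :
    x ^ i * y ^ j = w ^ (i * p + j * q) * ↑(τ ^ (α * j - β * i)) := by
  have h : τ ^ (α * j - β * i) = (τ ^ (-β)) ^ i * (τ ^ α) ^ j := by
    rw [← zpow_natCast, ← zpow_natCast, ← zpow_mul, ← zpow_mul, ← zpow_add]
    congr 1
    ring
  rw [h, hw.left, hw.right]
  push_cast
  ring

/-- An element of the `e`-th step of the weight filtration is divisible by `w ^ e`, and the residue of
the quotient is a combination of the residues of the quotients of the monomials of weight exactly `e`,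
those of larger weight having residue zero. -/
theorem IsMonomialPair.exists_eq_of_mem_weightFiltration (hw : IsMonomialPair x y w τ p q α β)
    (hA : ∀ a ∈ A, residue D a ∈ algebraicClosure (ResidueField R) (ResidueField D)) {e : ℕ}
    (M : Submodule (algebraicClosure (ResidueField R) (ResidueField D)) (ResidueField D))
    (hM : ∀ i j : ℕ, i * p + j * q = e → residue D ↑(τ ^ (α * j - β * i)) ∈ M) {f : D}
    (hf : f ∈ weightFiltration A x y p q e) : ∃ f', f = w ^ e * f' ∧ residue D f' ∈ M := by
  induction hf using Submodule.span_induction with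
  | mem f h =>
    obtain ⟨⟨i, j⟩, hs, rfl⟩ := h
    obtain ⟨d, hd⟩ := Nat.exists_eq_add_of_le (show e ≤ i * p + j * q from hs)
    refine ⟨w ^ d * ↑(τ ^ (α * j - β * i)), ?_, ?_⟩
    · simp only [hw.pow_mul_pow, hd, pow_add, mul_assoc]
    · rcases Nat.eq_zero_or_pos d with rfl | hd0
      · simpa using hM i j (by omega)
      · rw [map_mul, map_pow, (residue_eq_zero_iff _).2 hw.mem, zero_pow hd0.ne', zero_mul]
        exact zero_mem _
  | zero => exact ⟨0, by simp, by simp⟩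
  | add f g _ _ hf hg =>
    obtain ⟨f', rfl, hf'⟩ := hf
    obtain ⟨g', rfl, hg'⟩ := hg
    exact ⟨f' + g', by ring, by rw [map_add]; exact add_mem hf' hg'⟩
  | smul a f _ hf =>
    obtain ⟨f', rfl, hf'⟩ := hf
    refine ⟨a * f', ?_, ?_⟩
    · rw [Subalgebra.smul_def, smul_eq_mul]
      ring
    · rw [map_mul]
      exact M.smul_mem ⟨_, hA a a.2⟩ hf'

/-- Distinct monomials of the same weight differ by distinct powers of `τ`. -/
theorem IsMonomialPair.weight_injOn (hw : IsMonomialPair x y w τ p q α β) (e : ℕ) :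
    Set.InjOn (fun s : ℕ × ℕ => α * s.2 - β * s.1) {s | s.1 * p + s.2 * q = e} := by
  rintro ⟨i, j⟩ h ⟨i', j'⟩ h' hs
  have h1 : (i * p + j * q : ℤ) = i' * p + j' * q := by
    exact_mod_cast (show i * p + j * q = e from h).trans (show i' * p + j' * q = e from h').symm
  have hs : α * j - β * i = α * j' - β * i' := hs
  have hb := hw.bezout
  have hi : (i : ℤ) = i' := by
    linear_combination α * h1 - (q : ℤ) * hs - ((i : ℤ) - i') * hb
  have hj : (j : ℤ) = j' := by
    linear_combination β * h1 + (p : ℤ) * hs - ((j : ℤ) - j') * hb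
  exact Prod.ext (by exact_mod_cast hi) (by exact_mod_cast hj)

/-- If the residue of `τ` is transcendental, the value of an element of weight at least `e` exceeds
that of `w ^ e` only if the element has weight at least `e + 1`: the powers of the residue of `τ`
being independent, the coefficients of the monomials of weight `e` all have residue zero. -/
theorem IsParameterPair.mem_weightFiltration_succ [IsDomain D] (hA : IsParameterPair A x y)
    (hw : IsMonomialPair x y w τ p q α β)
    (hτ : Transcendental (ResidueField R) (residue D τ)) {e : ℕ} {f' : D}
    (hf : w ^ e * f' ∈ weightFiltration A x y p q e) (hf' : residue D f' = 0) :
    w ^ e * f' ∈ weightFiltration A x y p q (e + 1) := by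
  -- Split off the monomials of weight exactly `e`.
  have hsets : {s : ℕ × ℕ | e ≤ s.1 * p + s.2 * q}
      = {s | s.1 * p + s.2 * q = e} ∪ {s | e + 1 ≤ s.1 * p + s.2 * q} := by
    ext s
    simp only [Set.mem_ofPred_eq, Set.mem_union]
    omega
  have hf2 := hf
  rw [weightFiltration, hsets, Set.image_union, Submodule.span_union, Submodule.mem_sup] at hf2
  obtain ⟨u, hu, r, hr, hur⟩ := hf2
  obtain ⟨c, hc, rfl⟩ := (Finsupp.mem_span_image_iff_linearCombination A).1 hu
  rw [← hur]
  refine add_mem ?_ hr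
  obtain ⟨r', rfl, -⟩ :=
    hw.exists_eq_of_mem_weightFiltration hA.residue_mem ⊤ (fun _ _ _ => trivial) hr
  rw [Finsupp.mem_supported] at hc
  rw [Finsupp.linearCombination_apply, Finsupp.sum] at hur ⊢
  have hwres : residue D w = 0 := (residue_eq_zero_iff _).2 hw.mem
  have hsum : ∑ s ∈ c.support, (c s : D) * ↑(τ ^ (α * s.2 - β * s.1)) = f' - w * r' := by
    apply mul_left_cancel₀ (pow_ne_zero e hw.ne_zero)
    have h1 : w ^ e * ∑ s ∈ c.support, (c s : D) * ↑(τ ^ (α * s.2 - β * s.1))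
        = ∑ s ∈ c.support, c s • (x ^ s.1 * y ^ s.2) := by
      rw [Finset.mul_sum]
      refine Finset.sum_congr rfl fun s hs => ?_
      rw [hw.pow_mul_pow, show s.1 * p + s.2 * q = e from hc hs, Subalgebra.smul_def, smul_eq_mul]
      ring
    rw [h1]
    linear_combination hur
  have hres := congrArg (residue D) hsum
  rw [map_sum, map_sub, map_mul, hf', hwres, zero_mul, sub_zero] at hres
  have hinj : Function.Injective fun s : c.support => α * s.1.2 - β * s.1.1 := fun s s' h =>
    Subtype.ext (hw.weight_injOn e (hc s.2) (hc s'.2) h)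
  let k : c.support → algebraicClosure (ResidueField R) (ResidueField D) :=
    fun s => ⟨residue D (c s), hA.residue_mem _ (c s).2⟩
  have hli := hτ.algebraicClosure.linearIndependent_zpow.comp _ hinj
  have hk : ∑ s : c.support, k s • (residue D (τ : D)) ^ (α * s.1.2 - β * s.1.1) = 0 := by
    refine Eq.trans (Finset.sum_congr rfl fun s _ => ?_)
      ((Finset.sum_coe_sort c.support _).trans hres)
    rw [map_mul, residue_zpow]
    rfl
  refine Submodule.sum_mem _ fun s hs => ?_
  -- A coefficient with residue zero is a combination of `x` and `y`, which raises the weight.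
  obtain ⟨a, ha, b, hb, hab⟩ := hA.exists_eq (c s) (c s).2 (congrArg Subtype.val
    (Fintype.linearIndependent_iff.1 hli k hk ⟨s, hs⟩))
  have hs' : s.1 * p + s.2 * q = e := hc hs
  have hp := hw.pos_left
  have hq := hw.pos_right
  have h1 : x ^ (s.1 + 1) * y ^ s.2 ∈ weightFiltration A x y p q (e + 1) :=
    Submodule.subset_span ⟨(s.1 + 1, s.2), by
      change e + 1 ≤ (s.1 + 1) * p + s.2 * q
      rw [add_mul]; omega, rfl⟩
  have h2 : x ^ s.1 * y ^ (s.2 + 1) ∈ weightFiltration A x y p q (e + 1) :=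
    Submodule.subset_span ⟨(s.1, s.2 + 1), by
      change e + 1 ≤ s.1 * p + (s.2 + 1) * q
      rw [add_mul]; omega, rfl⟩
  have h3 := Submodule.add_mem _ (Submodule.smul_mem _ (⟨a, ha⟩ : A) h1)
    (Submodule.smul_mem _ (⟨b, hb⟩ : A) h2)
  convert h3 using 1
  rw [Subalgebra.smul_def, Subalgebra.smul_def, Subalgebra.smul_def, hab]
  simp only [smul_eq_mul]
  ring

theorem IsParameterPair.mem_weightFiltration [IsDomain D] (hA : IsParameterPair A x y)
    (hw : IsMonomialPair x y w τ p q α β)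
    (hτ : Transcendental (ResidueField R) (residue D τ)) (e : ℕ) {f' : D}
    (hf : w ^ e * f' ∈ A) : w ^ e * f' ∈ weightFiltration A x y p q e := by
  induction e generalizing f' with
  | zero =>
    have h1 : (1 : D) ∈ weightFiltration A x y p q 0 :=
      Submodule.subset_span ⟨(0, 0), Nat.zero_le _, by simp⟩
    have h2 := Submodule.smul_mem _ (⟨_, hf⟩ : A) h1
    rwa [Subalgebra.smul_def, smul_eq_mul, mul_one] at h2
  | succ e ih =>
    rw [pow_succ, mul_assoc] at hf ⊢
    refine hA.mem_weightFiltration_succ hw hτ (ih hf) ?_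
    rw [map_mul, (residue_eq_zero_iff _).2 hw.mem, zero_mul]

/-- If `z` is an element of `A` divided by a power of `x`, its residue is a polynomial in the residue
of `τ`, not merely a Laurent polynomial: the exponent of `y` in a monomial is nonnegative, and the
exponent of `τ` in the quotient of the monomial by the power of `x` is that exponent divided by
`p`. -/
theorem IsParameterPair.residue_mem_adjoin [IsDomain D]
    (hA : IsParameterPair A x y) (hw : IsMonomialPair x y w τ p q α β)
    (hτ : Transcendental (ResidueField R) (residue D τ)) {z : D} {m : ℕ} (hz : z * x ^ m ∈ A) :
    residue D z ∈ Algebra.adjoin (algebraicClosure (ResidueField R) (ResidueField D))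
      {residue D (τ : D)} := by
  set t := residue D (τ : D)
  have ht0 : t ≠ 0 := (residue_ne_zero_iff_isUnit _).2 τ.isUnit
  have hzx : z * x ^ m = w ^ (m * p) * (z * ↑(τ ^ (-β * m))) := by
    rw [hw.left, mul_pow, ← Units.val_pow_eq_pow_val, ← zpow_natCast (τ ^ (-β)), ← zpow_mul,
      mul_comm m, pow_mul]
    ring
  rw [hzx] at hz
  obtain ⟨f', hf, hf'⟩ := hw.exists_eq_of_mem_weightFiltration hA.residue_mem
    ((Algebra.adjoin (algebraicClosure (ResidueField R) (ResidueField D)) {t}).toSubmodule.comap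
      (LinearMap.mulRight _ (t ^ (β * m))))
    (fun i j hij => by
      have hij' : (i * p + j * q : ℤ) = m * p := by exact_mod_cast hij
      have hp : (p : ℤ) ∣ j := by
        refine IsCoprime.dvd_of_dvd_mul_right (z := (q : ℤ)) ⟨α, β, hw.bezout⟩ ⟨m - i, ?_⟩
        linear_combination hij'
      obtain ⟨k, hk⟩ := Int.natCast_dvd_natCast.1 hp
      have hexp : α * j - β * i + β * m = k := by
        have hp0 : (p : ℤ) ≠ 0 := by exact_mod_cast hw.pos_left.ne'
        have hk' : (j : ℤ) = p * k := by exact_mod_cast hk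
        apply mul_left_cancel₀ hp0
        linear_combination ((p : ℤ) * k) * hw.bezout + (p * α + β * q) * hk' - β * hij'
      rw [Submodule.mem_comap, LinearMap.mulRight_apply, residue_zpow, ← zpow_add₀ ht0, hexp,
        zpow_natCast]
      exact pow_mem (Algebra.self_mem_adjoin_singleton _ _) k)
    (hA.mem_weightFiltration hw hτ (m * p) hz)
  have h1 := mul_left_cancel₀ (pow_ne_zero _ hw.ne_zero) hf
  rw [← h1, Submodule.mem_comap, LinearMap.mulRight_apply, map_mul, residue_zpow, mul_assoc,
    ← zpow_add₀ ht0, neg_mul, neg_add_cancel, zpow_zero, mul_one] at hf'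
  exact hf'

end

section

variable {R D : Type*} [CommRing R] [IsLocalRing R] [CommRing D] [IsDomain D]
  [IsDiscreteValuationRing D] [Algebra R D] [IsLocalHom (algebraMap R D)] {A : Subalgebra R D}
  {w x y : D} {τ : Dˣ} {p q : ℕ} {α β : ℤ}

/-- If the residue of `τ` is transcendental, it generates the residue field of `D`: numerator and
denominator of a fraction can be divided by the same power of `w`, so that both residues become
Laurent polynomials in the residue of `τ`. -/
theorem IsParameterPair.adjoin_residue_eq_top
    (hA : IsParameterPair A x y) (hw : IsMonomialPair x y w τ p q α β)
    (hτ : Transcendental (ResidueField R) (residue D τ))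
    (hfrac : ∀ v : D, ∃ f ∈ A, ∃ g ∈ A, g ≠ 0 ∧ v * g = f) :
    IntermediateField.adjoin (algebraicClosure (ResidueField R) (ResidueField D))
      {residue D (τ : D)} = ⊤ := by
  rw [eq_top_iff]
  rintro l -
  obtain ⟨v, rfl⟩ := residue_surjective l
  set E := IntermediateField.adjoin (algebraicClosure (ResidueField R) (ResidueField D))
      {residue D (τ : D)}
  have hE : ∀ i j : ℕ, residue D ↑(τ ^ (α * j - β * i)) ∈ E.toSubalgebra.toSubmodule :=
    fun i j => by
      rw [residue_zpow]
      exact zpow_mem (IntermediateField.mem_adjoin_simple_self _ _) _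
  obtain ⟨f, hf, g, hg, hg0, rfl⟩ := hfrac v
  -- The exact weight of the denominator exists because a nonzero element of `D` is divisible by only
  -- finitely many powers of `w`.
  obtain ⟨e, he, he'⟩ : ∃ e, g ∈ weightFiltration A x y p q e ∧
      g ∉ weightFiltration A x y p q (e + 1) := by
    by_contra! hcon
    have hall : ∀ e, g ∈ weightFiltration A x y p q e := fun e => by
      induction e with
      | zero => simpa using hA.mem_weightFiltration hw hτ 0 (f' := g) (by simpa using hg)
      | succ e ih => exact hcon e ih
    obtain ⟨n, hn⟩ := FiniteMultiplicity.of_not_isUnit hw.mem hg0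
    obtain ⟨g', hg', -⟩ := hw.exists_eq_of_mem_weightFiltration hA.residue_mem ⊤
      (fun _ _ _ => trivial) (hall (n + 1))
    exact hn ⟨g', hg'⟩
  obtain ⟨g', rfl, hg'⟩ :=
    hw.exists_eq_of_mem_weightFiltration hA.residue_mem _ (fun i j _ => hE i j) he
  have hg'0 : residue D g' ≠ 0 := fun h => he' (hA.mem_weightFiltration_succ hw hτ he h)
  rw [mul_left_comm] at hf
  obtain ⟨f', hff', hf'⟩ := hw.exists_eq_of_mem_weightFiltration hA.residue_mem _
    (fun i j _ => hE i j) (hA.mem_weightFiltration hw hτ e hf)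
  have h1 : v * g' = f' := mul_left_cancel₀ (pow_ne_zero e hw.ne_zero) hff'
  rw [← h1, map_mul] at hf'
  have h2 := mul_mem (show residue D v * residue D g' ∈ E from hf')
    (inv_mem (show residue D g' ∈ E from hg'))
  rwa [mul_inv_cancel_right₀ hg'0] at h2

/-! ### Descent along monomial blow-ups -/

/-- The conclusion for any pair of parameters, by induction on the value of the denominator `x ^ m`
of `z`. -/
theorem IsParameterPair.exists_transcendental
    (hfrac : ∀ v : D, ∃ f g : R, algebraMap R D g ≠ 0 ∧ v * algebraMap R D g = algebraMap R D f)
    {z : D} (hz : Transcendental (ResidueField R) (residue D z)) (hA : IsParameterPair A x y)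
    {m : ℕ} (hzx : z * x ^ m ∈ A) :
    ∃ t : ResidueField D, Transcendental (ResidueField R) t ∧
      IntermediateField.adjoin (algebraicClosure (ResidueField R) (ResidueField D)) {t} = ⊤ ∧
      residue D z ∈ Algebra.adjoin (algebraicClosure (ResidueField R) (ResidueField D)) {t} := by
  obtain ⟨π, hπ⟩ := IsDiscreteValuationRing.exists_irreducible D
  obtain ⟨N, hN⟩ := FiniteMultiplicity.of_not_isUnit hπ.not_isUnit (pow_ne_zero m hA.left_ne_zero)
  replace hN : ∃ N, ¬ π ^ N ∣ x ^ m := ⟨_, hN⟩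
  obtain ⟨N, hN⟩ := hN
  induction N generalizing A x y m with
  | zero => simp at hN
  | succ N ih =>
    obtain ⟨w, τ, p, q, α, β, hw⟩ := exists_isMonomialPair hA.left_mem_maximalIdeal
      hA.left_ne_zero hA.right_mem_maximalIdeal hA.right_ne_zero
    by_cases hτ : Transcendental (ResidueField R) (residue D (τ : D))
    · refine ⟨_, hτ, hA.adjoin_residue_eq_top hw hτ fun v => ?_, hA.residue_mem_adjoin hw hτ hzx⟩
      obtain ⟨f, g, hg, h⟩ := hfrac v
      exact ⟨_, A.algebraMap_mem f, _, A.algebraMap_mem g, hg, h⟩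
    · have hτ' : residue D (τ : D) ∈ algebraicClosure (ResidueField R) (ResidueField D) :=
        mem_algebraicClosure_iff.2 (not_not.1 hτ)
      obtain ⟨y', hA'⟩ := hA.exists_toricTransform hw hτ'
      -- For `m = 0` the element `z` would lie in `A` and have algebraic residue.
      have hm : m ≠ 0 := by
        rintro rfl
        rw [pow_zero, mul_one] at hzx
        exact hz (mem_algebraicClosure_iff.1 (hA.residue_mem z hzx))
      have hmp : m * p ≠ 0 := mul_ne_zero hm hw.pos_left.ne'
      have hxm : x ^ m * ↑(τ ^ (β * m)) = w ^ (m * p) := by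
        rw [hw.left, mul_pow, ← Units.val_pow_eq_pow_val, ← zpow_natCast (τ ^ (-β)), ← zpow_mul,
          mul_assoc, ← Units.val_mul, ← zpow_add, neg_mul, neg_add_cancel, zpow_zero, Units.val_one,
          mul_one, mul_comm m, pow_mul]
      -- The numerator lies in the maximal ideal, so it is divisible by `w` in the blow-up.
      have hx0 : residue D (z * x ^ m) = 0 := by
        rw [map_mul, map_pow, (residue_eq_zero_iff _).2 hA.left_mem_maximalIdeal, zero_pow hm,
          mul_zero]
      obtain ⟨b, hb, hzb⟩ := hA.exists_eq_mul hw hzx hx0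
      refine ih hA' (m := m * p - 1) ?_ ?_
      · have h1 : z * w ^ (m * p - 1) = b * ↑(τ ^ (β * m)) := by
          apply mul_left_cancel₀ hw.ne_zero
          rw [mul_left_comm, mul_pow_sub_one hmp, ← hxm, ← mul_assoc, hzb, mul_assoc]
        rw [h1]
        exact mul_mem hb (unit_zpow_mem_toricTransform _)
      · intro hdvd
        apply hN
        have hπw : π ∣ w := by
          have := hw.mem
          rwa [hπ.maximalIdeal_eq, Ideal.mem_span_singleton] at this
        have h2 : π ^ (N + 1) ∣ x ^ m * ↑(τ ^ (β * m)) := by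
          rw [hxm, pow_succ, ← pow_sub_one_mul hmp]
          exact mul_dvd_mul hdvd hπw
        exact Units.dvd_mul_right.1 h2

end

theorem mainTheorem1
    {R : Type*} [CommRing R] [IsRegularLocalRing R] (hdim : ringKrullDim R = 2)
    {F : Type*} [Field F] [Algebra R F] [IsFractionRing R F]
    (V : ValuationSubring F) [Algebra R V] [IsScalarTower R V F] [IsLocalHom (algebraMap R V)]
    (z : F) (hz : IsDicriticalDivisor R V z)
    (x : R) (hx : x ∈ maximalIdeal R) (hx' : x ∉ maximalIdeal R ^ 2)
    (m : ℕ) (hzx : ∃ f : R, z * algebraMap R F x ^ m = algebraMap R F f) :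
    ∃ t : ResidueField V,
      Transcendental (ResidueField R) t ∧
      IntermediateField.adjoin (algebraicClosure (ResidueField R) (ResidueField V)) {t} = ⊤ ∧
      ∃ P : Polynomial (algebraicClosure (ResidueField R) (ResidueField V)),
        residue V ⟨z, hz.mem⟩ = Polynomial.aeval t P := by
  have := hz.isPrimeDivisor.isDiscreteValuationRing
  have hRF : ∀ r : R, ((algebraMap R V r : V) : F) = algebraMap R F r := fun r =>
    (IsScalarTower.algebraMap_apply R V F r).symm
  have hinj : Function.Injective (algebraMap R V) := fun a b hab =>
    IsFractionRing.injective R F (by rw [← hRF, ← hRF, hab])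
  have hmax : ∀ r ∈ maximalIdeal R, algebraMap R V r ∈ maximalIdeal V := fun r hr hu =>
    hr (isUnit_of_map_unit (algebraMap R V) r hu)
  have hx0 : x ≠ 0 := fun h => hx' (h ▸ zero_mem _)
  obtain ⟨y, hy, hy0, hgen⟩ : ∃ y ∈ maximalIdeal R, y ≠ 0 ∧ ∀ r ∈ maximalIdeal R,
      ∃ a b, a * x + b * y = r := by
    obtain ⟨y, hy⟩ := IsRegularLocalRing.exists_maximalIdeal_eq_span_pair hdim hx hx'
    have hgen : ∀ r ∈ maximalIdeal R, ∃ a b, a * x + b * y = r := fun r hr => by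
      rwa [hy, Ideal.mem_span_pair] at hr
    -- A parameter pair consists of nonzero elements, and `x` itself serves if `y` vanishes.
    by_cases hy0 : y = 0
    · refine ⟨x, hx, hx0, fun r hr => ?_⟩
      obtain ⟨a, b, h⟩ := hgen r hr
      exact ⟨a, 0, by rw [← h, hy0]; ring⟩
    · exact ⟨y, hy ▸ Ideal.subset_span (by simp), hy0, hgen⟩
  have hA : IsParameterPair (⊥ : Subalgebra R V) (algebraMap R V x) (algebraMap R V y) := by
    refine ⟨Subalgebra.algebraMap_mem _ x, Subalgebra.algebraMap_mem _ y, hmax x hx, hmax y hy,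
      (map_ne_zero_iff _ hinj).2 hx0, (map_ne_zero_iff _ hinj).2 hy0, ?_, ?_⟩
    · intro a ha ha0
      obtain ⟨r, rfl⟩ := Algebra.mem_bot.1 ha
      have hr : r ∈ maximalIdeal R := fun hu =>
        (residue_ne_zero_iff_isUnit _).2 (hu.map (algebraMap R V)) ha0
      obtain ⟨b, c, rfl⟩ := hgen r hr
      exact ⟨_, Subalgebra.algebraMap_mem _ b, _, Subalgebra.algebraMap_mem _ c, by simp⟩
    · intro a ha
      obtain ⟨r, rfl⟩ := Algebra.mem_bot.1 ha
      rw [← ResidueField.algebraMap_residue]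
      exact (algebraicClosure (ResidueField R) (ResidueField V)).algebraMap_mem _
  obtain ⟨f, hf⟩ := hzx
  have hzx' : (⟨z, hz.mem⟩ : V) * algebraMap R V x ^ m ∈ (⊥ : Subalgebra R V) := by
    refine Algebra.mem_bot.2 ⟨f, Subtype.ext ?_⟩
    simp [hRF, hf]
  obtain ⟨t, ht, htop, hzt⟩ := hA.exists_transcendental (fun v => by
    obtain ⟨f, g, hg, h⟩ := IsFractionRing.div_surjective (A := R) (v : F)
    have hg0 : algebraMap R F g ≠ 0 := IsFractionRing.to_map_ne_zero_of_mem_nonZeroDivisors hg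
    refine ⟨f, g, fun h0 => hg0 (by rw [← hRF, h0]; rfl), Subtype.ext ?_⟩
    simp [hRF, ← h, hg0]) hz.transcendental_residue hzx'
  rw [Algebra.adjoin_singleton_eq_range_aeval] at hzt
  obtain ⟨P, hP⟩ := hzt
  exact ⟨t, ht, htop, P, hP.symm⟩
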